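/- Let $X$ be a reflexive real Banach space with topological dual $X^*$, let $C\subseteq X$ be nonempty, closed and convex, and let $F:C\times C\to\mathbb{R}$ satisfy $F(x,x)=0$ for all $x\in C$. Suppose that $F$ is BO-maximal monotone (Blum--Oettli maximal monotone), that is, $F$ is monotone, meaning $F(x,y)+F(y,x)\le 0$ for all $x,y\in C$, and for every $(x,x^*)\in C\times X^*$ the following implication holds: $$F(y,x)+\langle x^*,y-x\rangle\le 0\ \ \forall y\in C\quad\Longrightarrow\quad F(x,y)\ge\langle x^*,y-x\rangle\ \ \forall y\in C.$$ If $F(x,\cdot)$ is convex and lower semicontinuous on $C$ for all $x\in C$, then $F$ is maximal monotone; that is, $F$ is monotone and the operator $A^F:X\rightrightarrows X^*$ given by $$A^F(x)=\{x^*\in X^*: F(x,y)-F(x,x)\ge\langle x^*,y-x\rangle\ \ \forall y\in C\}\ \text{ if } x\in C,\qquad A^F(x)=\emptyset\ \text{ if } x\notin C,$$ is a maximal monotone operator: $\langle y^*-x^*,y-x\rangle\ge 0$ whenever $x^*\in A^F(x)$ and $y^*\in A^F(y)$, and the graph of $A^F$ is not properly included in the graph of any other operator $X\rightrightarrows X^*$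 with this monotonicity property. -/

import Mathlib

/-- A real normed space is reflexive: the canonical embedding into its bidual is onto. -/
def IsReflexiveSpace (X : Type*) [NormedAddCommGroup X] [NormedSpace ℝ X] : Prop :=
  Function.Surjective (NormedSpace.inclusionInDoubleDual ℝ X)

/-- The graph of a multifunction `T : X ⇉ X*`. -/
def operatorGraph {X : Type*} [NormedAddCommGroup X] [NormedSpace ℝ X]
    (T : X → Set (StrongDual ℝ X)) : Set (X × StrongDual ℝ X) :=
  {p | p.2 ∈ T p.1}

/-- `T : X ⇉ X*` is a monotone operator. -/
def IsMonotoneOperator {X : Type*} [NormedAddCommGroup X] [NormedSpace ℝ X]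
    (T : X → Set (StrongDual ℝ X)) : Prop :=
  ∀ x y : X, ∀ x' ∈ T x, ∀ y' ∈ T y, 0 ≤ (y' - x') (y - x)

/-- `T` is maximal monotone: it is monotone and its graph is not properly included in the
graph of any monotone operator. -/
def IsMaximalMonotoneOperator {X : Type*} [NormedAddCommGroup X] [NormedSpace ℝ X]
    (T : X → Set (StrongDual ℝ X)) : Prop :=
  IsMonotoneOperator T ∧
    ∀ S : X → Set (StrongDual ℝ X), IsMonotoneOperator S → ¬ operatorGraph T ⊂ operatorGraph S

/-- `F : C × C → ℝ` is a monotone bifunction. A bifunction on `C` is represented by a total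
function `F : X → X → ℝ`, of which only the values on `C × C` are ever used. -/
def IsMonotoneBifunction {X : Type*} (C : Set X) (F : X → X → ℝ) : Prop :=
  ∀ x ∈ C, ∀ y ∈ C, F x y + F y x ≤ 0

/-- The operator `A^F : X ⇉ X*` of a bifunction `F` on `C`; it is empty-valued off `C`. -/
def bifunctionOperator {X : Type*} [NormedAddCommGroup X] [NormedSpace ℝ X]
    (C : Set X) (F : X → X → ℝ) (x : X) : Set (StrongDual ℝ X) :=
  {x' | x ∈ C ∧ ∀ y ∈ C, x' (y - x) ≤ F x y - F x x}

/-- A maximal monotone bifunction: `F` is monotone and `A^F` is a maximal monotone operator. -/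
def IsMaximalMonotoneBifunction {X : Type*} [NormedAddCommGroup X] [NormedSpace ℝ X]
    (C : Set X) (F : X → X → ℝ) : Prop :=
  IsMonotoneBifunction C F ∧ IsMaximalMonotoneOperator (bifunctionOperator C F)

/-- A BO-maximal monotone (Blum-Oettli maximal monotone) bifunction. -/
def IsBOMaximalMonotoneBifunction {X : Type*} [NormedAddCommGroup X] [NormedSpace ℝ X]
    (C : Set X) (F : X → X → ℝ) : Prop :=
  IsMonotoneBifunction C F ∧
    ∀ x ∈ C, ∀ x' : StrongDual ℝ X,
      (∀ y ∈ C, F y x + x' (y - x) ≤ 0) → ∀ y ∈ C, x' (y - x) ≤ F x y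

/-! Let φ(u,u') = sup_y (u'(y) + F(y,u)), convex with φ(u,u') ≥ u'(u) since F(u,u) = 0. For (x₀,x₀')
monotonically related to the graph of A^F, Hahn–Banach separation of the epigraph of φ from a
quadratic centred at (x₀,x₀'), with reflexivity, yields a pair (x,x')
(`exists_fitzpatrick_separation`). Since F(u,·) is the supremum of its affine minorants, x ∈ C and
F(u,x) + x'(u-x) ≤ -D with D ≥ 0, so BO-maximality puts x' in A^F(x). Then u = x and the monotone
relation force (x,x') = (x₀,x₀'). -/

/-- A convex set lying above the hypograph of a continuous concave function is separated from it
by the graph of a continuous affine function. -/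
theorem exists_affine_separation {E : Type*} [NormedAddCommGroup E] [NormedSpace ℝ E]
    {S : Set (E × ℝ)} (hS : Convex ℝ S) (hSne : S.Nonempty) {g : E → ℝ}
    (hg : ConvexOn ℝ Set.univ g) (hgc : Continuous g) (h : ∀ p ∈ S, 0 ≤ p.2 + g p.1) :
    ∃ L : StrongDual ℝ E, ∀ p ∈ S, ∀ q, L q - g q ≤ p.2 + L p.1 := by
  have hconv : Convex ℝ {p : E × ℝ | p.1 ∈ Set.univ ∧ p.2 < (-g) p.1} :=
    hg.neg.convex_strict_hypograph
  have hopen : IsOpen {p : E × ℝ | p.1 ∈ Set.univ ∧ p.2 < (-g) p.1} := by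
    simp only [Set.mem_univ, true_and, Pi.neg_apply]
    exact isOpen_lt continuous_snd (hgc.comp continuous_fst).neg
  have hdisj : Disjoint {p : E × ℝ | p.1 ∈ Set.univ ∧ p.2 < (-g) p.1} S := by
    rw [Set.disjoint_left]
    rintro p ⟨-, hp⟩ hpS
    have := h p hpS
    simp only [Pi.neg_apply] at hp
    linarith
  obtain ⟨f, u, hfA, hfS⟩ := geometric_hahn_banach_open hconv hopen hS hdisj
  have hsplit : ∀ (q : E) (t : ℝ), f (q, t) = f (q, 0) + t * f (0, 1) := by
    intro q t
    have : ((q, t) : E × ℝ) = (q, 0) + t • (0, 1) := by ext <;> simp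
    rw [this, map_add, map_smul, smul_eq_mul]
  have hlt : ∀ p ∈ S, ∀ (q : E) (t : ℝ), t < -g q →
      f (q, 0) + t * f (0, 1) < f (p.1, 0) + p.2 * f (0, 1) := by
    intro p hp q t ht
    rw [← hsplit, ← hsplit]
    exact (hfA (q, t) ⟨trivial, ht⟩).trans_le (hfS p hp)
  obtain ⟨p₀, hp₀⟩ := hSne
  -- Comparing two heights over the same base point shows that the hyperplane is not vertical.
  have hc : 0 < f (0, 1) := by
    have h1 := hlt p₀ hp₀ p₀.1 (-g p₀.1 - 1) (by linarith)
    have h2 := h p₀ hp₀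
    by_contra hc
    nlinarith
  refine ⟨(f (0, 1))⁻¹ • f.comp (ContinuousLinearMap.inl ℝ E ℝ), fun p hp q => ?_⟩
  simp only [smul_apply, ContinuousLinearMap.comp_apply,
    ContinuousLinearMap.inl_apply, smul_eq_mul]
  refine le_of_forall_pos_le_add fun ε hε => ?_
  have h1 := hlt p hp q (-g q - ε) (by linarith)
  have h2 := mul_le_mul_of_nonneg_left h1.le (inv_pos.2 hc).le
  have h3 : (f (0, 1))⁻¹ * f (0, 1) = 1 := inv_mul_cancel₀ hc.ne'
  linear_combination h2 + (p.2 + g q + ε) * h3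

/-- Half the squared dual norm is bounded by the conjugate of half the squared norm. -/
theorem half_sq_opNorm_le {E : Type*} [NormedAddCommGroup E] [NormedSpace ℝ E]
    (a : StrongDual ℝ E) {M : ℝ} (h : ∀ v, a v - 1 / 2 * ‖v‖ ^ 2 ≤ M) :
    1 / 2 * ‖a‖ ^ 2 ≤ M := by
  have hM : 0 ≤ M := by simpa using h 0
  have hle : ‖a‖ ≤ Real.sqrt (2 * M) := by
    refine a.opNorm_le_bound (Real.sqrt_nonneg _) fun v => ?_
    rw [Real.norm_eq_abs]
    refine abs_le_of_sq_le_sq ?_ (by positivity)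
    rw [mul_pow, Real.sq_sqrt (by positivity)]
    have hquad : ∀ t : ℝ, 0 ≤ (1 / 2 * ‖v‖ ^ 2) * (t * t) + (-a v) * t + M := by
      intro t
      have := h (t • v)
      rw [map_smul, norm_smul, mul_pow, Real.norm_eq_abs, sq_abs, smul_eq_mul] at this
      linarith
    have := discrim_le_zero hquad
    rw [discrim] at this
    linarith
  have := pow_le_pow_left₀ (norm_nonneg a) hle 2
  rw [Real.sq_sqrt (by positivity)] at this
  linarith

theorem exists_affine_minorant {E : Type*} [NormedAddCommGroup E] [NormedSpace ℝ E] {C : Set E}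
    (hC : IsClosed C) {φ : E → ℝ} (hφ : ConvexOn ℝ C φ) (hφc : LowerSemicontinuousOn φ C)
    {x : E} {a : ℝ} (hx : x ∈ C) (ha : a < φ x) :
    ∃ (l : StrongDual ℝ E) (r : ℝ), (∀ y ∈ C, l y - r ≤ φ y) ∧ l x - r = a := by
  obtain ⟨l, c, h1, h2⟩ := hφ.exists_affine_le_of_lt (𝕜 := ℝ) hx ha hC hφc
  refine ⟨l, -c, fun y hy => ?_, by simpa using h2⟩
  simpa using h1 ⟨y, hy⟩

/-- A bound at `x` for all continuous affine minorants of a convex lower semicontinuous function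
on a closed set is a bound for the function, with `x` in its domain. -/
theorem mem_and_le_of_affine_minorants_le {E : Type*} [NormedAddCommGroup E] [NormedSpace ℝ E]
    {C : Set E} (hC : IsClosed C) (hCne : C.Nonempty) {φ : E → ℝ} (hφ : ConvexOn ℝ C φ)
    (hφc : LowerSemicontinuousOn φ C) {x : E} {M : ℝ}
    (h : ∀ (l : StrongDual ℝ E) (r : ℝ), (∀ y ∈ C, l y - r ≤ φ y) → l x - r ≤ M) :
    x ∈ C ∧ φ x ≤ M := by
  have hx : x ∈ C := by
    by_contra hx
    obtain ⟨u, hu⟩ := hCne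
    obtain ⟨l, r, hl, -⟩ := exists_affine_minorant hC hφ hφc hu (sub_one_lt (φ u))
    obtain ⟨f, s, hfC, hfx⟩ := geometric_hahn_banach_closed_point hφ.1 hC hx
    -- Off C, tilting a minorant by t(f - s), which is negative on C and positive at x, makes its
    -- value at x unbounded.
    have key : ∀ t : ℝ, 0 ≤ t → (l x - r) + t * (f x - s) ≤ M := by
      intro t ht
      have := h (l + t • f) (r + t * s) fun y hy => by
        have h1 := hl y hy
        have h2 := mul_nonneg ht (sub_nonneg.2 (hfC y hy).le)
        simp only [add_apply, smul_apply, smul_eq_mul]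
        linarith
      simp only [add_apply, smul_apply,
        smul_eq_mul] at this
      linarith
    have hpos : 0 < f x - s := sub_pos.2 hfx
    have h0 := key 0 le_rfl
    have h1 := key ((M - (l x - r) + 1) / (f x - s)) (div_nonneg (by linarith) hpos.le)
    rw [div_mul_cancel₀ _ hpos.ne'] at h1
    linarith
  refine ⟨hx, le_of_forall_lt fun a ha => ?_⟩
  obtain ⟨b, hab, hb⟩ := exists_between ha
  obtain ⟨l, r, hl, hlx⟩ := exists_affine_minorant hC hφ hφc hx hb
  exact hab.trans_le (hlx ▸ h l r hl)

/-- The epigraph of the Fitzpatrick transform of a bifunction. -/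
def fitzpatrickEpigraph {X : Type*} [NormedAddCommGroup X] [NormedSpace ℝ X]
    (C : Set X) (F : X → X → ℝ) : Set ((X × StrongDual ℝ X) × ℝ) :=
  {q | q.1.1 ∈ C ∧ ∀ y ∈ C, q.1.2 y + F y q.1.1 ≤ q.2}

theorem convex_fitzpatrickEpigraph {X : Type*} [NormedAddCommGroup X] [NormedSpace ℝ X]
    {C : Set X} {F : X → X → ℝ} (hC : Convex ℝ C) (hF : ∀ x ∈ C, ConvexOn ℝ C (F x)) :
    Convex ℝ (fitzpatrickEpigraph C F) := by
  rintro ⟨⟨u, u'⟩, r⟩ ⟨hu, hur⟩ ⟨⟨v, v'⟩, s⟩ ⟨hv, hvs⟩ a b ha hb hab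
  refine ⟨hC hu hv ha hb hab, fun y hy => ?_⟩
  have h1 := (hF y hy).2 hu hv ha hb hab
  have h2 := mul_le_mul_of_nonneg_left (hur y hy) ha
  have h3 := mul_le_mul_of_nonneg_left (hvs y hy) hb
  simp only [Prod.smul_mk, Prod.mk_add_mk, add_apply,
    smul_apply, smul_eq_mul] at h1 h2 h3 ⊢
  linarith

/-- For a monotone bifunction, continuous affine minorants of `F u` give points of the epigraph
of the Fitzpatrick transform. -/
theorem mem_fitzpatrickEpigraph_of_minorant {X : Type*} [NormedAddCommGroup X] [NormedSpace ℝ X]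
    {C : Set X} {F : X → X → ℝ} (hF : IsMonotoneBifunction C F) {u : X} (hu : u ∈ C)
    {l : StrongDual ℝ X} {r : ℝ} (h : ∀ y ∈ C, l y - r ≤ F u y) :
    ((u, l), r) ∈ fitzpatrickEpigraph C F := by
  refine ⟨hu, fun y hy => ?_⟩
  have h1 := h y hy
  have h2 := hF u hu y hy
  dsimp only
  linarith

theorem apply_add_half_sq_nonneg {X : Type*} [NormedAddCommGroup X] [NormedSpace ℝ X]
    (l : StrongDual ℝ X) (v : X) : 0 ≤ l v + (1 / 2 * ‖v‖ ^ 2 + 1 / 2 * ‖l‖ ^ 2) := by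
  have h1 := (abs_le.1 (l.le_opNorm v)).1
  nlinarith [sq_nonneg (‖v‖ - ‖l‖)]

theorem convexOn_half_sq_dist {E : Type*} [NormedAddCommGroup E] [NormedSpace ℝ E] (x₀ : E) :
    ConvexOn ℝ Set.univ fun x => 1 / 2 * ‖x - x₀‖ ^ 2 := by
  have h := (convexOn_univ_norm (E := E)).pow (fun _ _ => norm_nonneg _) 2
  have h' := (h.smul (c := (1 / 2 : ℝ)) (by norm_num)).translate_left (-x₀)
  simpa [Function.comp_def, sub_eq_add_neg] using h'

/-- Existence of a point whose displacement from `(x₀, x₀')` controls the epigraph of the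
Fitzpatrick transform. -/
theorem exists_fitzpatrick_separation {X : Type*} [NormedAddCommGroup X] [NormedSpace ℝ X]
    (hX : IsReflexiveSpace X) {C : Set X} (hC : Convex ℝ C) {F : X → X → ℝ}
    (hF0 : ∀ x ∈ C, F x x = 0) (hF : ∀ x ∈ C, ConvexOn ℝ C (F x))
    (hne : (fitzpatrickEpigraph C F).Nonempty) (x₀ : X) (x₀' : StrongDual ℝ X) :
    ∃ (x : X) (x' : StrongDual ℝ X), ∀ u u' r, ((u, u'), r) ∈ fitzpatrickEpigraph C F →
      (x₀' - x') (x₀ - x) + (1 / 2 * ‖x₀ - x‖ ^ 2 + 1 / 2 * ‖x₀' - x'‖ ^ 2)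
        ≤ r - x' u - u' x + x' x := by
  let ev : X →L[ℝ] StrongDual ℝ (StrongDual ℝ X) := NormedSpace.inclusionInDoubleDual ℝ X
  let lin : (X × StrongDual ℝ X) →L[ℝ] ℝ :=
    x₀'.comp (ContinuousLinearMap.fst ℝ X (StrongDual ℝ X)) +
      (ev x₀).comp (ContinuousLinearMap.snd ℝ X (StrongDual ℝ X))
  have hlin : ∀ p, lin p = x₀' p.1 + p.2 x₀ := fun p => rfl
  -- Chosen so that u'(u) + g(u,u') = (u' - x₀')(u - x₀) plus the two half squares, which is
  -- nonnegative.
  let g : X × StrongDual ℝ X → ℝ := fun p =>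
    (1 / 2 * ‖p.1 - x₀‖ ^ 2 + 1 / 2 * ‖p.2 - x₀'‖ ^ 2) + (-lin) p + x₀' x₀
  have hg : ConvexOn ℝ Set.univ g := by
    have h1 := (convexOn_half_sq_dist x₀).comp_linearMap (LinearMap.fst ℝ X (StrongDual ℝ X))
    have h2 := (convexOn_half_sq_dist x₀').comp_linearMap (LinearMap.snd ℝ X (StrongDual ℝ X))
    have h3 := ((-lin).toLinearMap.convexOn convex_univ)
    exact ((h1.add h2).add h3).add_const (x₀' x₀)
  have hgc : Continuous g := by
    have := (-lin).continuous
    fun_prop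
  obtain ⟨L, hL⟩ := exists_affine_separation (convex_fitzpatrickEpigraph hC hF) hne hg hgc (by
    rintro ⟨⟨u, u'⟩, r⟩ ⟨hu, hur⟩
    have h1 := hur u hu
    have h2 := apply_add_half_sq_nonneg (u' - x₀') (u - x₀)
    simp only [g, neg_apply, hlin, hF0 u hu, sub_apply,
      map_sub] at h1 h2 ⊢
    linarith)
  -- Reflexivity: the component of L on the dual is evaluation at a point b of X.
  obtain ⟨b, hb⟩ := hX (L.comp (ContinuousLinearMap.inr ℝ X (StrongDual ℝ X)))
  let a : StrongDual ℝ X := L.comp (ContinuousLinearMap.inl ℝ X (StrongDual ℝ X))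
  have hLab : ∀ v v', L (v, v') = a v + v' b := by
    intro v v'
    have h1 : v' b = L (0, v') := by
      change NormedSpace.inclusionInDoubleDual ℝ X b v' = _; rw [hb]; rfl
    have h2 : a v = L (v, 0) := rfl
    rw [h1, h2, ← map_add]
    simp
  refine ⟨-b, -a, fun u u' r hu => ?_⟩
  -- Recentring at (x₀,x₀') decouples w from w', so each supremum can be taken separately and gives
  -- a half squared norm.
  have key : ∀ w w', ((x₀' - -a) w - 1 / 2 * ‖w‖ ^ 2) + (ev (x₀ - -b) w' - 1 / 2 * ‖w'‖ ^ 2) ≤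
      r + a u + u' b + a b - (x₀' - -a) (x₀ - -b) := by
    intro w w'
    have h := hL _ hu (x₀ + w, x₀' + w')
    have hev : ev (x₀ - -b) w' = w' (x₀ - -b) := rfl
    simp only [g, hLab, hlin, neg_apply, sub_apply,
      add_apply, map_sub, map_neg, map_add, add_sub_cancel_left] at h hev ⊢
    linarith
  have h1 : ∀ w', (ev (x₀ - -b) w' - 1 / 2 * ‖w'‖ ^ 2) ≤
      r + a u + u' b + a b - (x₀' - -a) (x₀ - -b) - 1 / 2 * ‖x₀' - -a‖ ^ 2 := by
    intro w'
    have := half_sq_opNorm_le (x₀' - -a) fun w => le_sub_iff_add_le.2 (key w w')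
    linarith
  have h2 := half_sq_opNorm_le _ h1
  have h3 : ‖ev (x₀ - -b)‖ = ‖x₀ - -b‖ :=
    (NormedSpace.inclusionInDoubleDualLi (E := X) ℝ).norm_map (x₀ - -b)
  rw [h3] at h2
  simp only [neg_apply, map_neg] at h2 ⊢
  linarith

theorem isMonotoneOperator_bifunctionOperator {X : Type*} [NormedAddCommGroup X]
    [NormedSpace ℝ X] {C : Set X} {F : X → X → ℝ} (hF0 : ∀ x ∈ C, F x x = 0)
    (hF : IsMonotoneBifunction C F) : IsMonotoneOperator (bifunctionOperator C F) := by
  rintro x y x' ⟨hx, hx'⟩ y' ⟨hy, hy'⟩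
  have h1 := hx' y hy
  have h2 := hy' x hx
  have h3 := hF x hx y hy
  rw [hF0 x hx] at h1
  rw [hF0 y hy] at h2
  simp only [map_sub, sub_apply] at h1 h2 ⊢
  linarith

/-- A point monotonically related to the graph of `A^F` belongs to it. -/
theorem mem_bifunctionOperator_of_monotonicallyRelated {X : Type*} [NormedAddCommGroup X]
    [NormedSpace ℝ X] (hX : IsReflexiveSpace X) {C : Set X} (hCne : C.Nonempty)
    (hCcl : IsClosed C) (hCconv : Convex ℝ C) {F : X → X → ℝ} (hF0 : ∀ x ∈ C, F x x = 0)
    (hFBO : IsBOMaximalMonotoneBifunction C F) (hFconv : ∀ x ∈ C, ConvexOn ℝ C (F x))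
    (hFlsc : ∀ x ∈ C, LowerSemicontinuousOn (F x) C) {x₀ : X} {x₀' : StrongDual ℝ X}
    (h : ∀ x, ∀ x' ∈ bifunctionOperator C F x, 0 ≤ (x₀' - x') (x₀ - x)) :
    x₀' ∈ bifunctionOperator C F x₀ := by
  obtain ⟨hFm, hBO⟩ := hFBO
  have hne : (fitzpatrickEpigraph C F).Nonempty := by
    obtain ⟨u, hu⟩ := hCne
    obtain ⟨l, r, hl, -⟩ :=
      exists_affine_minorant hCcl (hFconv u hu) (hFlsc u hu) hu (sub_one_lt (F u u))
    exact ⟨_, mem_fitzpatrickEpigraph_of_minorant hFm hu hl⟩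
  obtain ⟨x, x', hx⟩ := exists_fitzpatrick_separation hX hCconv hF0 hFconv hne x₀ x₀'
  set D := (x₀' - x') (x₀ - x) + (1 / 2 * ‖x₀ - x‖ ^ 2 + 1 / 2 * ‖x₀' - x'‖ ^ 2) with hD
  have hD0 : 0 ≤ D := apply_add_half_sq_nonneg (x₀' - x') (x₀ - x)
  have hle : ∀ u ∈ C, x ∈ C ∧ F u x ≤ x' x - x' u - D := fun u hu =>
    mem_and_le_of_affine_minorants_le hCcl hCne (hFconv u hu) (hFlsc u hu) fun l r hl => by
      have := hx u l r (mem_fitzpatrickEpigraph_of_minorant hFm hu hl)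
      linarith
  obtain ⟨u, hu⟩ := hCne
  have hxC : x ∈ C := (hle u hu).1
  have hmem : x' ∈ bifunctionOperator C F x := by
    refine ⟨hxC, fun y hy => ?_⟩
    rw [hF0 x hxC, sub_zero]
    refine hBO x hxC x' (fun z hz => ?_) y hy
    have := (hle z hz).2
    rw [map_sub]
    linarith
  have h1 := h x x' hmem
  -- The choice u = x gives D ≤ 0, while D is a nonnegative pairing plus half squares.
  have h2 := (hle x hxC).2
  rw [hF0 x hxC] at h2
  have hn1 : ‖x₀ - x‖ = 0 := by nlinarith [sq_nonneg ‖x₀ - x‖, sq_nonneg ‖x₀' - x'‖]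
  have hn2 : ‖x₀' - x'‖ = 0 := by nlinarith [sq_nonneg ‖x₀ - x‖, sq_nonneg ‖x₀' - x'‖]
  rw [sub_eq_zero.1 (norm_eq_zero.1 hn1), sub_eq_zero.1 (norm_eq_zero.1 hn2)]
  exact hmem

theorem mainTheorem11 {X : Type*} [NormedAddCommGroup X] [NormedSpace ℝ X] [CompleteSpace X]
    (hX : IsReflexiveSpace X) (C : Set X) (hCne : C.Nonempty) (hCcl : IsClosed C)
    (hCconv : Convex ℝ C) (F : X → X → ℝ) (hF0 : ∀ x ∈ C, F x x = 0)
    (hFBO : IsBOMaximalMonotoneBifunction C F)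
    (hFconv : ∀ x ∈ C, ConvexOn ℝ C (F x))
    (hFlsc : ∀ x ∈ C, LowerSemicontinuousOn (F x) C) :
    IsMaximalMonotoneBifunction C F := by
  refine ⟨hFBO.1, isMonotoneOperator_bifunctionOperator hF0 hFBO.1, fun S hS hsub => ?_⟩
  refine hsub.2 fun p hp => ?_
  exact mem_bifunctionOperator_of_monotonicallyRelated hX hCne hCcl hCconv hF0 hFBO hFconv hFlsc
    fun x x' hx' => hS x p.1 x' (hsub.subset (show (x, x') ∈ operatorGraph _ from hx')) p.2 hp
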